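/- Let $\Omega \subset \mathbb{R}^2$ be open, let $\Omega' \subset \Omega$ be open and nonempty, and let $(\mathcal{T}_h)_h$ be a family of triangulations of $\Omega$, that is, conforming families of nondegenerate triangles, locally finite in $\Omega$, whose union contains $\Omega$ and is contained in $\overline{\Omega}$. A function $v$ on $\Omega$ is called $P_1$ on $\mathcal{T}_h$ if it is continuous on $\Omega$ and coincides on each triangle (intersected with $\Omega$) with an affine function; it is called convex if it is convex on every convex subset of $\Omega$ (for convex $\Omega$ this is ordinary convexity). Assume that the family satisfies property (PM) in $\Omega'$: there are two linearly independent unit vectors $\mathbf{a}, \mathbf{b} \in \mathbb{R}^2$ (the same for all $h$) such that $(\mathbf{n}\cdot\mathbf{a})(\mathbf{n}\cdot\mathbf{b}) \ge 0$ for every $h$ and every unit normal $\mathbf{n}$ to an edge of $\mathcal{T}_h$ that meets $\Omega'$. Then there exist $\varepsilon > 0$ and a $\mathcal{C}^\infty$ convex function $u_{exact} : \mathbb{R}^2 \to \mathbb{R}$, of the quadratic form $u_{exact}(\mathbf{x}) = \tfrac12 \mathbf{x}' \mathbf{C}^{-1} \mathbf{x} - k$ with $\mathbf{C}$ a symmetric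 positive definite $2\times 2$ matrix and $k \in \mathbb{R}$, such that for every $h$ and every convex $P_1$ function $u_h$ on $\mathcal{T}_h$ $$\| u_h - u_{exact} \|_{L^2(\Omega)} \ge \varepsilon ,$$ and even locally $\| u_h - u_{exact} \|_{L^2(\Omega')} \ge \varepsilon$ (the norms may be $+\infty$). -/

import Mathlib

open scoped ContDiff Topology Matrix

/-- The Euclidean plane. -/
abbrev Plane : Type := EuclideanSpace ℝ (Fin 2)

/-- `K` is a (conforming) triangulation of `Ω`. A `Geometry.SimplicialComplex` is given by the vertex
sets of its simplices, which are affinely independent and pairwise meet in common faces. The complex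
may be infinite, so that `Ω` need not be polygonal, but it is locally finite in `Ω`. -/
structure IsTriangulation (K : Geometry.SimplicialComplex ℝ Plane) (Ω : Set Plane) : Prop where
  /-- Every vertex and every edge belongs to a triangle. -/
  pure : ∀ s ∈ K.faces, ∃ t ∈ K.faces, t.card = 3 ∧ s ⊆ t
  /-- The triangles cover `Ω`. -/
  covers : Ω ⊆ K.space
  /-- The triangles do not leave the closure of `Ω`. -/
  space_subset : K.space ⊆ closure Ω
  /-- Every point of `Ω` has a neighbourhood that meets only finitely many simplices. -/
  locallyFinite : ∀ x ∈ Ω, ∃ U ∈ 𝓝 x,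
    {s ∈ K.faces | (convexHull ℝ (s : Set Plane) ∩ U).Nonempty}.Finite

/-- For the given vectors `a`, `b`: `(n · a)(n · b) ≥ 0` for every unit normal `n` to an edge of the
mesh that meets `Ω'`. -/
def EdgeNormalSign (K : Geometry.SimplicialComplex ℝ Plane) (Ω' : Set Plane) (a b : Plane) : Prop :=
  ∀ e ∈ K.faces, e.card = 2 → (convexHull ℝ (e : Set Plane) ∩ Ω').Nonempty →
    ∀ n : Plane, ‖n‖ = 1 → (∀ p ∈ e, ∀ q ∈ e, inner ℝ n (p - q) = 0) →
      0 ≤ inner ℝ n a * inner ℝ n b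

/-- `u` is a `P₁` finite element function in `Ω` on the mesh `K`: it is continuous, and on each
triangle it coincides with an affine function. -/
def IsP1 (K : Geometry.SimplicialComplex ℝ Plane) (Ω : Set Plane) (u : Plane → ℝ) : Prop :=
  ContinuousOn u Ω ∧
    ∀ t ∈ K.faces, t.card = 3 →
      ∃ A : Plane →ᵃ[ℝ] ℝ, ∀ x ∈ convexHull ℝ (t : Set Plane) ∩ Ω, u x = A x

/-- Convexity of a function in an open set `Ω` that need not be convex: convexity on every convex
subset of `Ω`. See `isConvexIn_iff_convexOn` for convex `Ω`. -/
def IsConvexIn (Ω : Set Plane) (u : Plane → ℝ) : Prop :=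
  ∀ s : Set Plane, s ⊆ Ω → Convex ℝ s → ConvexOn ℝ s u

/-- In a convex set this is convexity in the usual sense. -/
theorem isConvexIn_iff_convexOn {Ω : Set Plane} (hΩ : Convex ℝ Ω) (u : Plane → ℝ) :
    IsConvexIn Ω u ↔ ConvexOn ℝ Ω u :=
  ⟨fun h => h Ω subset_rfl hΩ, fun h _ hs hc => h.subset hs hc⟩

/-! The distributional Hessian of a convex `P₁` function is carried by the edges, with density a
nonnegative gradient jump times n ⊗ n. Under (PM), ∂_a ∂_b u_h is therefore a nonnegative measure in
Ω', whatever the mesh size. A quadratic with a'C⁻¹b < 0 has a negative constant ∂_a ∂_b, so no such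
u_h can approach it. The proof replaces distributions by mixed second differences over
parallelograms with sides along a and b. They are additive under subdivision, so their sign is a
local matter (`mixedDiff_nonneg_of_locally`). Away from vertices u_h is affine or has one convex
kink (`isRidgeAt_of_not_vertex`); vertices are isolated and disappear by continuity
(`MixedNonnegAt.of_punctured`). Over parallelograms of fixed size the error thus has mixed
difference at least δ > 0, and `le_eLpNorm_of_mixedDiff` turns this into an L² bound independent of
h. -/

/-! ### Mixed second differences: from local to global -/

/-- The mixed second difference of `G` over the rectangle `[s₀, s₁] × [t₀, t₁]`. -/
def mixedDiff (G : ℝ → ℝ → ℝ) (s₀ s₁ t₀ t₁ : ℝ) : ℝ :=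
  G s₁ t₁ - G s₀ t₁ - G s₁ t₀ + G s₀ t₀

/-- Mixed second differences of `G` over small rectangles near `(σ, τ)` are nonnegative. -/
def MixedNonnegAt (G : ℝ → ℝ → ℝ) (σ τ : ℝ) : Prop :=
  ∃ r > 0, ∀ s₀ s₁ t₀ t₁, s₀ ≤ s₁ → t₀ ≤ t₁ → |s₀ - σ| < r → |s₁ - σ| < r → |t₀ - τ| < r →
    |t₁ - τ| < r → 0 ≤ mixedDiff G s₀ s₁ t₀ t₁

/-- Mixed differences add up over the four quarters of a rectangle, so repeated bisection reduces
the claim to arbitrarily small rectangles. -/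
theorem mixedDiff_nonneg_of_locally {G : ℝ → ℝ → ℝ} {s₀ s₁ t₀ t₁ : ℝ} (hs : s₀ ≤ s₁)
    (ht : t₀ ≤ t₁) (h : ∀ σ ∈ Set.Icc s₀ s₁, ∀ τ ∈ Set.Icc t₀ t₁, MixedNonnegAt G σ τ) :
    0 ≤ mixedDiff G s₀ s₁ t₀ t₁ := by
  rcases hs.eq_or_lt with rfl | hs
  · simp [mixedDiff]
  rcases ht.eq_or_lt with rfl | ht
  · simp [mixedDiff]
  let I : BoxIntegral.Box (Fin 2) := ⟨![s₀, t₀], ![s₁, t₁], by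
    intro i; fin_cases i <;> simpa⟩
  suffices H : 0 ≤ mixedDiff G (I.lower 0) (I.upper 0) (I.lower 1) (I.upper 1) by simpa [I] using H
  refine BoxIntegral.Box.subbox_induction_on' (p := fun J : BoxIntegral.Box (Fin 2) =>
    0 ≤ mixedDiff G (J.lower 0) (J.upper 0) (J.lower 1) (J.upper 1)) I ?_ ?_
  · intro J _ hJ
    -- The four subsets of `Fin 2` index the four quarters.
    have h1 := hJ ∅
    have h2 := hJ {0}
    have h3 := hJ {1}
    have h4 := hJ Set.univ
    simp [BoxIntegral.Box.splitCenterBox, mixedDiff, Set.piecewise] at h1 h2 h3 h4 ⊢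
    linarith
  · intro z hz
    have hz' : z ∈ Set.Icc ![s₀, t₀] ![s₁, t₁] := hz
    have hz0 : z 0 ∈ Set.Icc s₀ s₁ := ⟨by simpa using hz'.1 0, by simpa using hz'.2 0⟩
    have hz1 : z 1 ∈ Set.Icc t₀ t₁ := ⟨by simpa using hz'.1 1, by simpa using hz'.2 1⟩
    obtain ⟨r, hr, H⟩ := h _ hz0 _ hz1
    refine ⟨Metric.ball z r, mem_nhdsWithin_of_mem_nhds (Metric.ball_mem_nhds z hr), ?_⟩
    intro J _ _ _ hJ _
    have hl : dist J.lower z < r := hJ J.lower_mem_Icc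
    have hu : dist J.upper z < r := hJ J.upper_mem_Icc
    rw [dist_pi_lt_iff hr] at hl hu
    exact H _ _ _ _ (J.lower_le_upper 0) (J.lower_le_upper 1) (hl 0) (hu 0) (hl 1) (hu 1)

/-- An isolated point where the function is continuous does not matter for the sign of mixed
second differences. -/
theorem MixedNonnegAt.of_punctured {G : ℝ → ℝ → ℝ} {σ τ r : ℝ} (hr : 0 < r)
    (hc : ∀ t, |t - τ| < r → ContinuousAt (fun s => G s t) σ)
    (h : ∀ s t, |s - σ| < r → |t - τ| < r → s ≠ σ → MixedNonnegAt G s t) :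
    MixedNonnegAt G σ τ := by
  refine ⟨r, hr, fun s₀ s₁ t₀ t₁ hs ht hs₀ hs₁ ht₀ ht₁ => ?_⟩
  rw [abs_lt] at hs₀ hs₁ ht₀ ht₁
  -- Rectangles on one side of the line s = σ avoid the exceptional point. Those touching the line
  -- follow by continuity in s, and those crossing it are cut along it.
  have key : ∀ a b, a ≤ b → -r < a - σ → b - σ < r → (b < σ ∨ σ < a) →
      0 ≤ mixedDiff G a b t₀ t₁ := by
    intro a b hab ha hb hσ
    refine mixedDiff_nonneg_of_locally hab ht fun s hs t ht => h s t ?_ ?_ ?_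
    · rw [abs_lt]; constructor <;> linarith [hs.1, hs.2]
    · rw [abs_lt]; constructor <;> linarith [ht.1, ht.2]
    · rintro rfl; rcases hσ with hσ | hσ <;> linarith [hs.1, hs.2]
  have c₀ := hc t₀ (abs_lt.2 ht₀)
  have c₁ := hc t₁ (abs_lt.2 ht₁)
  have left : ∀ a, a ≤ σ → -r < a - σ → 0 ≤ mixedDiff G a σ t₀ t₁ := by
    intro a ha har
    rcases ha.eq_or_lt with rfl | ha
    · simp [mixedDiff]
    have hcont : ContinuousAt (fun s => mixedDiff G a s t₀ t₁) σ := by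
      unfold mixedDiff; fun_prop
    refine ge_of_tendsto (hcont.tendsto.mono_left (nhdsWithin_le_nhds (s := Set.Iio σ))) ?_
    filter_upwards [Ioo_mem_nhdsLT ha] with s hs
    exact key a s hs.1.le har (by linarith [hs.2]) (Or.inl hs.2)
  have right : ∀ b, σ ≤ b → b - σ < r → 0 ≤ mixedDiff G σ b t₀ t₁ := by
    intro b hb hbr
    rcases hb.eq_or_lt with rfl | hb
    · simp [mixedDiff]
    have hcont : ContinuousAt (fun s => mixedDiff G s b t₀ t₁) σ := by
      unfold mixedDiff; fun_prop
    refine ge_of_tendsto (hcont.tendsto.mono_left (nhdsWithin_le_nhds (s := Set.Ioi σ))) ?_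
    filter_upwards [Ioo_mem_nhdsGT hb] with s hs
    exact key s b hs.2.le (by linarith [hs.1]) hbr (Or.inr hs.1)
  rcases lt_or_ge s₁ σ with h₁ | h₁
  · exact key _ _ hs hs₀.1 hs₁.2 (Or.inl h₁)
  rcases lt_or_ge σ s₀ with h₀ | h₀
  · exact key _ _ hs hs₀.1 hs₁.2 (Or.inr h₀)
  have hl := left s₀ h₀ hs₀.1
  have hr := right s₁ h₁ hs₁.2
  unfold mixedDiff at *
  linarith

/-! ### Ridges have nonnegative mixed differences -/

/-- Near `w`, the function `v` is the sum of an affine function and of a convex function of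
`⟪n, x - w⟫` with a kink at `0`, where `(n · a)(n · b) ≥ 0`. -/
def IsRidgeAt (v : Plane → ℝ) (a b w : Plane) : Prop :=
  ∃ (A : Plane →ᵃ[ℝ] ℝ) (n : Plane) (l m ρ : ℝ), 0 ≤ inner ℝ n a * inner ℝ n b ∧ 0 ≤ m ∧ 0 < ρ ∧
    ∀ x ∈ Metric.ball w ρ, v x = A x + l * inner ℝ n (x - w) + m * max (inner ℝ n (x - w)) 0

/-- A second difference of a convex function of one variable is nonnegative when the two steps p, q
do not have opposite signs. -/
theorem max_zero_mixed_nonneg {z p q : ℝ} (h : 0 ≤ p * q) :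
    0 ≤ max (z + p + q) 0 - max (z + p) 0 - max (z + q) 0 + max z 0 := by
  rcases le_total 0 p with hp | hp <;> rcases le_total 0 q with hq | hq
  · simp only [max_def]; split_ifs <;> linarith
  · rcases mul_nonneg_iff.1 h with h | h
    · have : q = 0 := le_antisymm hq h.2
      subst this; simp
    · have : p = 0 := le_antisymm h.1 hp
      subst this; simp
  · rcases mul_nonneg_iff.1 h with h | h
    · have : p = 0 := le_antisymm hp h.1
      subst this; simp
    · have : q = 0 := le_antisymm h.2 hq
      subst this; simp
  · simp only [max_def]; split_ifs <;> linarith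

/-- The affine part has zero mixed difference. Along a and b the argument of the kink moves by
multiples of n · a and n · b, to which `max_zero_mixed_nonneg` applies. -/
theorem IsRidgeAt.mixedNonnegAt {v : Plane → ℝ} {a b c w : Plane} {σ τ : ℝ} (ha : ‖a‖ = 1)
    (hb : ‖b‖ = 1) (hw : c + σ • a + τ • b = w) (h : IsRidgeAt v a b w) :
    MixedNonnegAt (fun s t => v (c + s • a + t • b)) σ τ := by
  obtain ⟨A, n, l, m, ρ, hn, hm, hρ, H⟩ := h
  have sub : ∀ s t : ℝ, c + s • a + t • b - w = (s - σ) • a + (t - τ) • b := by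
    intro s t; rw [← hw]; module
  have mem : ∀ s t : ℝ, |s - σ| < ρ / 2 → |t - τ| < ρ / 2 →
      c + s • a + t • b ∈ Metric.ball w ρ := by
    intro s t hs ht
    rw [mem_ball_iff_norm, sub]
    refine (norm_add_le _ _).trans_lt ?_
    rw [norm_smul, norm_smul, ha, hb, Real.norm_eq_abs, Real.norm_eq_abs]
    linarith
  refine ⟨ρ / 2, by positivity, fun s₀ s₁ t₀ t₁ hs ht hs₀ hs₁ ht₀ ht₁ => ?_⟩
  have hpq : 0 ≤ (s₁ - s₀) * inner ℝ n a * ((t₁ - t₀) * inner ℝ n b) := by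
    have := mul_nonneg (mul_nonneg (sub_nonneg.2 hs) (sub_nonneg.2 ht)) hn
    linarith
  have key := mul_nonneg hm
    (max_zero_mixed_nonneg (z := (s₀ - σ) * inner ℝ n a + (t₀ - τ) * inner ℝ n b) hpq)
  have e1 : (s₀ - σ) * inner ℝ n a + (t₀ - τ) * inner ℝ n b + (s₁ - s₀) * inner ℝ n a =
    (s₁ - σ) * inner ℝ n a + (t₀ - τ) * inner ℝ n b := by ring
  have e2 : (s₀ - σ) * inner ℝ n a + (t₀ - τ) * inner ℝ n b + (t₁ - t₀) * inner ℝ n b =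
    (s₀ - σ) * inner ℝ n a + (t₁ - τ) * inner ℝ n b := by ring
  have e3 : (s₁ - σ) * inner ℝ n a + (t₀ - τ) * inner ℝ n b + (t₁ - t₀) * inner ℝ n b =
    (s₁ - σ) * inner ℝ n a + (t₁ - τ) * inner ℝ n b := by ring
  rw [e1, e2, e3] at key
  have val : ∀ s t : ℝ, |s - σ| < ρ / 2 → |t - τ| < ρ / 2 →
      v (c + s • a + t • b) = A.linear c + s * A.linear a + t * A.linear b + A 0 +
        l * ((s - σ) * inner ℝ n a + (t - τ) * inner ℝ n b) +
        m * max ((s - σ) * inner ℝ n a + (t - τ) * inner ℝ n b) 0 := by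
    intro s t hs ht
    rw [H _ (mem s t hs ht), sub, inner_add_right, inner_smul_right, inner_smul_right, A.decomp]
    simp
  simp only [mixedDiff]
  rw [val _ _ hs₁ ht₁, val _ _ hs₀ ht₁, val _ _ hs₁ ht₀, val _ _ hs₀ ht₀]
  linarith

/-! ### Local structure of a triangulation -/

namespace IsTriangulation

variable {K : Geometry.SimplicialComplex ℝ Plane} {Ω : Set Plane}

/-- Near a point of `Ω` there are only simplices that contain this point. -/
theorem eventually_mem_convexHull (hK : IsTriangulation K Ω) {w : Plane} (hw : w ∈ Ω) :
    ∀ᶠ x in 𝓝 w, ∀ s ∈ K.faces, x ∈ convexHull ℝ (s : Set Plane) →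
      w ∈ convexHull ℝ (s : Set Plane) := by
  obtain ⟨U, hU, hF⟩ := hK.locallyFinite w hw
  have h := (Filter.eventually_all_finite hF (l := 𝓝 w) (p := fun s x =>
    x ∈ convexHull ℝ (s : Set Plane) → w ∈ convexHull ℝ (s : Set Plane))).2 (by
      intro s _
      by_cases hs : w ∈ convexHull ℝ (s : Set Plane)
      · exact Filter.Eventually.of_forall fun _ _ => hs
      · have hcl : IsClosed (convexHull ℝ (s : Set Plane)) :=
          s.finite_toSet.isClosed_convexHull (𝕜 := ℝ)
        filter_upwards [hcl.isOpen_compl.mem_nhds hs] with x hx hx'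
        exact absurd hx' hx)
  filter_upwards [h, hU] with x hx hxU s hs hxs
  exact hx s ⟨hs, x, hxs, hxU⟩ hxs

/-- Every point of `Ω` has a carrier: a simplex contained in all the simplices through it. -/
theorem exists_carrier (hK : IsTriangulation K Ω) {w : Plane} (hw : w ∈ Ω) :
    ∃ e ∈ K.faces, w ∈ convexHull ℝ (e : Set Plane) ∧
      ∀ s ∈ K.faces, w ∈ convexHull ℝ (s : Set Plane) → e ⊆ s := by
  classical
  obtain ⟨e₀, he₀⟩ := Geometry.SimplicialComplex.mem_space_iff.1 (hK.covers hw)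
  -- Take a simplex through w with fewest vertices: by conformity its intersection with any other
  -- simplex through w is again a face through w.
  obtain ⟨e, ⟨he, hwe⟩, hmin⟩ := (measure (Finset.card (α := Plane))).wf.has_min
    {s | s ∈ K.faces ∧ w ∈ convexHull ℝ (s : Set Plane)} ⟨e₀, he₀⟩
  refine ⟨e, he, hwe, fun s hs hws => ?_⟩
  have hmem : w ∈ convexHull ℝ ((e ∩ s : Finset Plane) : Set Plane) := by
    rw [Finset.coe_inter]
    exact K.inter_subset_convexHull he hs ⟨hwe, hws⟩
  have hne : (e ∩ s).Nonempty := by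
    rw [← Finset.coe_nonempty, ← convexHull_nonempty_iff (𝕜 := ℝ)]
    exact ⟨w, hmem⟩
  have hf := K.down_closed he Finset.inter_subset_left hne
  have hcard : ¬ (e ∩ s).card < e.card := hmin _ ⟨hf, hmem⟩
  exact Finset.inter_eq_left.1
    (Finset.eq_of_subset_of_card_le Finset.inter_subset_left (not_lt.1 hcard))

theorem exists_triangle (hK : IsTriangulation K Ω) {x : Plane} (hx : x ∈ Ω) :
    ∃ t ∈ K.faces, t.card = 3 ∧ x ∈ convexHull ℝ (t : Set Plane) := by
  obtain ⟨s, hs, hxs⟩ := Geometry.SimplicialComplex.mem_space_iff.1 (hK.covers hx)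
  obtain ⟨t, ht, h3, hst⟩ := hK.pure s hs
  exact ⟨t, ht, h3, convexHull_mono (Finset.coe_subset.2 hst) hxs⟩

theorem finite_simplices_through (hK : IsTriangulation K Ω) {w : Plane} (hw : w ∈ Ω) :
    {s ∈ K.faces | w ∈ convexHull ℝ (s : Set Plane)}.Finite := by
  obtain ⟨U, hU, hF⟩ := hK.locallyFinite w hw
  exact hF.subset fun s hs => ⟨hs.1, w, hs.2, mem_of_mem_nhds hU⟩

end IsTriangulation

/-! ### Convex `P₁` functions are ridges away from vertices -/

theorem exists_unit_inner_eq_zero {d : Plane} (hd : d ≠ 0) :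
    ∃ n : Plane, ‖n‖ = 1 ∧ inner ℝ n d = 0 := by
  have hd' : ‖d‖ ≠ 0 := norm_ne_zero_iff.2 hd
  refine ⟨‖d‖⁻¹ • !₂[-(d 1), d 0], ?_, ?_⟩
  · have : ‖(!₂[-(d 1), d 0] : Plane)‖ = ‖d‖ := by
      rw [EuclideanSpace.norm_eq, EuclideanSpace.norm_eq]
      congr 1
      simp [Fin.sum_univ_two, add_comm]
    rw [norm_smul, this, norm_inv, norm_norm, inv_mul_cancel₀ hd']
  · rw [inner_smul_left]
    simp [PiLp.inner_apply, Fin.sum_univ_two]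
    right; ring

/-- In the plane, a linear form that vanishes on a line is a multiple of the normal form. -/
theorem linear_eq_inner_normal {n d : Plane} (hn : ‖n‖ = 1) (hd : d ≠ 0) (hnd : inner ℝ n d = 0)
    (L : Plane →ₗ[ℝ] ℝ) (hL : L d = 0) (y : Plane) : L y = L n * inner ℝ n y := by
  have hn' : n 0 * n 0 + n 1 * n 1 = 1 := by
    have := real_inner_self_eq_norm_sq n
    rw [hn, PiLp.inner_apply, Fin.sum_univ_two] at this
    simpa only [RCLike.inner_apply, conj_trivial, one_pow] using this
  -- Expansion in the orthonormal basis of n and its quarter turn; d is a nonzero multiple of the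
  -- latter.
  have dec : ∀ z : Plane, z = (inner ℝ n z) • n + (n 0 * z 1 - n 1 * z 0) • !₂[-(n 1), n 0] := by
    intro z
    ext i
    fin_cases i
    · simp [PiLp.inner_apply, Fin.sum_univ_two]
      linear_combination (-z 0) * hn'
    · simp [PiLp.inner_apply, Fin.sum_univ_two]
      linear_combination (-z 1) * hn'
  have hp : L !₂[-(n 1), n 0] = 0 := by
    have h := dec d
    rw [hnd, zero_smul, zero_add] at h
    rw [h, map_smul, smul_eq_mul] at hL
    refine (mul_eq_zero.1 hL).resolve_left fun h0 => hd ?_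
    rw [h, h0, zero_smul]
  conv_lhs => rw [dec y]
  rw [map_add, map_smul, map_smul, hp]
  simp [mul_comm]

/-- A continuous function that is, at each point of a half ball `0 < ⟪n, x - w⟫`, one of finitely
many multiples of `⟪n, x - w⟫` is a fixed multiple of it. -/
theorem exists_slope_of_finite {r : Plane → ℝ} {n w : Plane} {ρ : ℝ} {T : Set ℝ} (hT : T.Finite)
    (hTne : T.Nonempty) (hr : ContinuousOn r (Metric.ball w ρ))
    (h : ∀ x ∈ Metric.ball w ρ, ∃ l ∈ T, r x = l * inner ℝ n (x - w)) :
    ∃ l, ∀ x ∈ Metric.ball w ρ, 0 < inner ℝ n (x - w) → r x = l * inner ℝ n (x - w) := by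
  set S := Metric.ball w ρ ∩ {x | 0 < inner ℝ n (x - w)} with hS
  have hconv : Convex ℝ S := by
    refine (convex_ball w ρ).inter ?_
    have : {x : Plane | 0 < inner ℝ n (x - w)} = {x | inner ℝ n w < innerₛₗ ℝ n x} := by
      ext x; simp [inner_sub_right]
    rw [this]
    exact convex_halfSpace_gt (innerₛₗ ℝ n).isLinear _
  have hcont : ContinuousOn (fun x => r x / inner ℝ n (x - w)) S := by
    refine (hr.mono Set.inter_subset_left).div (by fun_prop) fun x hx => ?_
    exact ne_of_gt hx.2
  -- The quotient is continuous on a connected set with values in a finite set, hence constant.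
  obtain ⟨l, -, hl⟩ := hconv.isPreconnected.eqOn_const_of_mapsTo hT.isDiscrete hcont (by
    intro x hx
    obtain ⟨l, hl, hxl⟩ := h x hx.1
    have : inner ℝ n (x - w) ≠ 0 := ne_of_gt hx.2
    simpa [hxl, this] using hl) hTne
  refine ⟨l, fun x hx hpos => ?_⟩
  have := hl ⟨hx, hpos⟩
  simp only [Function.const_apply] at this
  rw [← this, div_mul_cancel₀ _ hpos.ne']

/-- Away from the vertices, a convex `P₁` function is locally a ridge. -/
theorem isRidgeAt_of_not_vertex {K : Geometry.SimplicialComplex ℝ Plane} {Ω Ω' : Set Plane}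
    (hK : IsTriangulation K Ω) (hΩ : IsOpen Ω) (hsub : Ω' ⊆ Ω) {a b : Plane}
    (hE : EdgeNormalSign K Ω' a b) {v : Plane → ℝ} (hv : IsP1 K Ω v) (hc : IsConvexIn Ω v)
    {w : Plane} (hw : w ∈ Ω') (hvert : {w} ∉ K.faces) : IsRidgeAt v a b w := by
  have hwΩ := hsub hw
  obtain ⟨e, he, hwe, hmin⟩ := hK.exists_carrier hwΩ
  obtain ⟨ρ, hρ, hball⟩ := Metric.eventually_nhds_iff_ball.1
    ((hΩ.eventually_mem hwΩ).and (hK.eventually_mem_convexHull hwΩ))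
  -- The triangles near `w` contain the carrier `e`.
  have near : ∀ x ∈ Metric.ball w ρ, ∃ t ∈ K.faces, t.card = 3 ∧
      x ∈ convexHull ℝ (t : Set Plane) ∧ w ∈ convexHull ℝ (t : Set Plane) ∧ e ⊆ t := by
    intro x hx
    obtain ⟨t, ht, h3, hxt⟩ := hK.exists_triangle (hball x hx).1
    have hwt := (hball x hx).2 t ht hxt
    exact ⟨t, ht, h3, hxt, hwt, hmin t ht hwt⟩
  choose! A hA using hv.2
  obtain ⟨t₀, ht₀, h₀3, -, hwt₀, het₀⟩ := near w (Metric.mem_ball_self hρ)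
  have hcard : e.card ≤ 3 := h₀3 ▸ Finset.card_le_card het₀
  have hpos : 0 < e.card := (Geometry.SimplicialComplex.nonempty_of_mem_faces he).card_pos
  have hne1 : e.card ≠ 1 := by
    intro h1
    obtain ⟨p, rfl⟩ := Finset.card_eq_one.1 h1
    have : w = p := by simpa using hwe
    exact hvert (this ▸ he)
  have h23 : e.card = 2 ∨ e.card = 3 := by omega
  rcases h23 with h2 | h3
  swap
  -- The carrier is a triangle: w is interior to it and v is affine nearby, a ridge without kink.
  · refine ⟨A e, 0, 0, 0, ρ, by simp, le_rfl, hρ, fun x hx => ?_⟩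
    obtain ⟨t, ht, ht3, hxt, -, het⟩ := near x hx
    have : e = t := Finset.eq_of_subset_of_card_le het (by omega)
    subst this
    simpa using hA e ht ht3 x ⟨hxt, (hball x hx).1⟩
  obtain ⟨p, q, hpq, rfl⟩ := Finset.card_eq_two.1 h2
  have hwseg : w ∈ segment ℝ p q := by simpa [convexHull_pair] using hwe
  obtain ⟨κ, hκ, hwκ⟩ := (segment_eq_image' ℝ p q ▸ hwseg : w ∈ _)
  have hwp : p ≠ w := by
    rintro rfl
    exact hvert (K.down_closed he (by simp) (by simp))
  have hd : p - w ≠ 0 := sub_ne_zero.2 hwp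
  obtain ⟨n, hn, hnd⟩ := exists_unit_inner_eq_zero hd
  have hpw : p - w = κ • (p - q) := by rw [← hwκ]; simp only; module
  have hκ0 : κ ≠ 0 := by
    rintro rfl
    exact hd (by rw [hpw, zero_smul])
  have hnpq : inner ℝ n (p - q) = 0 := by
    rw [hpw, inner_smul_right] at hnd
    exact (mul_eq_zero.1 hnd).resolve_left hκ0
  have hsign : 0 ≤ inner ℝ n a * inner ℝ n b := by
    refine hE {p, q} he h2 ⟨w, hwe, hw⟩ n hn ?_
    have hnqp : inner ℝ n (q - p) = 0 := by
      rw [← neg_sub p q, inner_neg_right, hnpq, neg_zero]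
    intro y hy z hz
    simp only [Finset.mem_insert, Finset.mem_singleton] at hy hz
    rcases hy with rfl | rfl <;> rcases hz with rfl | rfl <;> simp [hnpq, hnqp]
  -- All the affine pieces agree with that of `t₀` along the edge.
  have slope : ∀ t ∈ K.faces, t.card = 3 → w ∈ convexHull ℝ (t : Set Plane) → ∀ x,
      A t x = A t₀ x + ((A t).linear n - (A t₀).linear n) * inner ℝ n (x - w) := by
    intro t ht h3 hwt x
    have hw1 : A t w = A t₀ w := by rw [← hA t ht h3 w ⟨hwt, hwΩ⟩, ← hA t₀ ht₀ h₀3 w ⟨hwt₀, hwΩ⟩]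
    -- The endpoint p may lie outside Ω, where v is not controlled, so a point of the edge close to
    -- w replaces it.
    obtain ⟨θ, hθ0, hθ1, hθ⟩ : ∃ θ : ℝ, 0 < θ ∧ θ ≤ 1 ∧ w + θ • (p - w) ∈ Ω := by
      have hcont : Filter.Tendsto (fun θ : ℝ => w + θ • (p - w)) (𝓝[>] 0) (𝓝 w) := by
        have : ContinuousAt (fun θ : ℝ => w + θ • (p - w)) 0 := by fun_prop
        simpa using this.tendsto.mono_left nhdsWithin_le_nhds
      obtain ⟨θ, h1, h2⟩ := ((hcont.eventually (hΩ.eventually_mem hwΩ)).and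
        (Ioc_mem_nhdsGT (zero_lt_one' ℝ))).exists
      exact ⟨θ, h2.1, h2.2, h1⟩
    have hz : ∀ t ∈ K.faces, ({p, q} : Finset Plane) ⊆ t →
        w + θ • (p - w) ∈ convexHull ℝ (t : Set Plane) := by
      intro t _ het
      refine convexHull_mono (Finset.coe_subset.2 het) ?_
      refine (convex_convexHull ℝ _).add_smul_sub_mem hwe ?_ ⟨hθ0.le, hθ1⟩
      exact subset_convexHull ℝ _ (by simp)
    have hz1 : A t (w + θ • (p - w)) = A t₀ (w + θ • (p - w)) := by
      rw [← hA t ht h3 _ ⟨hz t ht (hmin t ht hwt), hθ⟩, ← hA t₀ ht₀ h₀3 _ ⟨hz t₀ ht₀ het₀, hθ⟩]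
    have lin : ∀ (B : Plane →ᵃ[ℝ] ℝ) (y : Plane), B y = B w + B.linear (y - w) := by
      intro B y
      have := B.linearMap_vsub y w
      simp only [vsub_eq_sub] at this
      rw [this]; ring
    have hL : ((A t).linear - (A t₀).linear) (p - w) = 0 := by
      rw [lin (A t), lin (A t₀), hw1, add_sub_cancel_left, map_smul, map_smul] at hz1
      have : θ * ((A t).linear (p - w)) = θ * ((A t₀).linear (p - w)) := by
        simpa using hz1
      rw [LinearMap.sub_apply, mul_left_cancel₀ hθ0.ne' this, sub_self]
    have := linear_eq_inner_normal hn hd hnd _ hL (x - w)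
    simp only [LinearMap.sub_apply] at this
    rw [← this, lin (A t) x, lin (A t₀) x, hw1]
    ring
  -- Vertices and edges contribute arbitrary values of `A`; only finiteness matters.
  set T : Set ℝ := (fun t => (A t).linear n - (A t₀).linear n) ''
    {s ∈ K.faces | w ∈ convexHull ℝ (s : Set Plane)} with hTdef
  have hT : T.Finite := (hK.finite_simplices_through hwΩ).image _
  have hTne : T.Nonempty := ⟨_, t₀, ⟨ht₀, hwt₀⟩, rfl⟩
  have hr : ContinuousOn (fun x => v x - A t₀ x) (Metric.ball w ρ) := by
    refine (hv.1.mono fun x hx => (hball x hx).1).sub ?_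
    exact (AffineMap.continuous_of_finiteDimensional _).continuousOn
  have val : ∀ x ∈ Metric.ball w ρ, ∃ l ∈ T, v x - A t₀ x = l * inner ℝ n (x - w) := by
    intro x hx
    obtain ⟨t, ht, h3, hxt, hwt, -⟩ := near x hx
    refine ⟨_, ⟨t, ⟨ht, hwt⟩, rfl⟩, ?_⟩
    rw [hA t ht h3 x ⟨hxt, (hball x hx).1⟩, slope t ht h3 hwt x]
    ring
  obtain ⟨l₁, hl₁⟩ := exists_slope_of_finite hT hTne hr val
  obtain ⟨l₂, hl₂⟩ := exists_slope_of_finite (n := -n) (hT.image (fun l => -l)) (hTne.image _) hr (by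
    intro x hx
    obtain ⟨l, hl, hxl⟩ := val x hx
    exact ⟨-l, ⟨l, hl, rfl⟩, by rw [hxl, inner_neg_left]; ring⟩)
  -- Convexity along the normal gives the sign of the jump.
  have hnn : inner ℝ n n = (1 : ℝ) := by rw [real_inner_self_eq_norm_sq, hn]; norm_num
  have hjump : 0 ≤ l₁ + l₂ := by
    have mem₁ : w + (ρ / 2) • n ∈ Metric.ball w ρ := by
      rw [mem_ball_iff_norm, add_sub_cancel_left, norm_smul, hn, Real.norm_of_nonneg (by positivity)]
      linarith
    have mem₂ : w - (ρ / 2) • n ∈ Metric.ball w ρ := by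
      rw [mem_ball_iff_norm, sub_sub_cancel_left, norm_neg, norm_smul, hn,
        Real.norm_of_nonneg (by positivity)]
      linarith
    have i₁ : inner ℝ n (w + (ρ / 2) • n - w) = ρ / 2 := by
      rw [add_sub_cancel_left, inner_smul_right, hnn, mul_one]
    have i₂ : inner ℝ (-n) (w - (ρ / 2) • n - w) = ρ / 2 := by
      rw [sub_sub_cancel_left, inner_neg_neg, inner_smul_right, hnn, mul_one]
    have h₁ := hl₁ _ mem₁ (by rw [i₁]; positivity)
    have h₂ := hl₂ _ mem₂ (by rw [i₂]; positivity)
    rw [i₁] at h₁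
    rw [i₂] at h₂
    obtain ⟨l, -, hl⟩ := val w (Metric.mem_ball_self hρ)
    rw [sub_self, inner_zero_right, mul_zero] at hl
    have hconv := (hc _ (fun x hx => (hball x hx).1) (convex_ball w ρ)).2 mem₁ mem₂
      (by norm_num : (0 : ℝ) ≤ 1 / 2) (by norm_num : (0 : ℝ) ≤ 1 / 2) (by norm_num)
    have hmid : (1 / 2 : ℝ) • (w + (ρ / 2) • n) + (1 / 2 : ℝ) • (w - (ρ / 2) • n) = w := by module
    rw [hmid, smul_eq_mul, smul_eq_mul] at hconv
    have hAdd : A t₀ (w + (ρ / 2) • n) + A t₀ (w - (ρ / 2) • n) = 2 * A t₀ w := by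
      rw [(A t₀).decomp]
      simp
      ring
    have : 0 ≤ (l₁ + l₂) * (ρ / 2) := by linarith
    exact nonneg_of_mul_nonneg_left this (by positivity)
  -- Since l₂ is measured along -n, the slope along n goes from -l₂ to l₁ across the edge.
  refine ⟨A t₀, n, -l₂, l₁ + l₂, ρ, hsign, hjump, hρ, fun x hx => ?_⟩
  rcases lt_trichotomy (inner ℝ n (x - w)) 0 with hneg | h0 | hpos
  · have := hl₂ x hx (by rw [inner_neg_left]; linarith)
    rw [inner_neg_left] at this
    rw [max_eq_right hneg.le]
    linarith
  · obtain ⟨l, -, hl⟩ := val x hx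
    rw [h0] at hl ⊢
    simp at hl ⊢
    linarith
  · have := hl₁ x hx hpos
    rw [max_eq_left hpos.le]
    linarith

/-- Mixed second differences of a convex `P₁` function in the directions `a`, `b` are
nonnegative. -/
theorem mixedDiff_nonneg_of_isP1 {K : Geometry.SimplicialComplex ℝ Plane} {Ω Ω' : Set Plane}
    (hK : IsTriangulation K Ω) (hΩ : IsOpen Ω) (hΩ' : IsOpen Ω') (hsub : Ω' ⊆ Ω) {a b : Plane}
    (ha : ‖a‖ = 1) (hb : ‖b‖ = 1) (hab : LinearIndependent ℝ ![a, b])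
    (hE : EdgeNormalSign K Ω' a b) {v : Plane → ℝ} (hv : IsP1 K Ω v) (hc : IsConvexIn Ω v)
    {c : Plane} {s₀ s₁ t₀ t₁ : ℝ} (hs : s₀ ≤ s₁) (ht : t₀ ≤ t₁)
    (hmem : ∀ s ∈ Set.Icc s₀ s₁, ∀ t ∈ Set.Icc t₀ t₁, c + s • a + t • b ∈ Ω') :
    0 ≤ mixedDiff (fun s t => v (c + s • a + t • b)) s₀ s₁ t₀ t₁ := by
  refine mixedDiff_nonneg_of_locally hs ht fun σ hσ τ hτ => ?_
  have hwmem := hmem σ hσ τ hτ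
  set w := c + σ • a + τ • b with hw
  obtain ⟨ρ, hρ, hball⟩ := Metric.eventually_nhds_iff_ball.1
    ((hΩ'.eventually_mem hwmem).and (hK.eventually_mem_convexHull (hsub hwmem)))
  have mem : ∀ s t : ℝ, |s - σ| < ρ / 2 → |t - τ| < ρ / 2 →
      c + s • a + t • b ∈ Metric.ball w ρ := by
    intro s t hs ht
    have : c + s • a + t • b - w = (s - σ) • a + (t - τ) • b := by rw [hw]; module
    rw [mem_ball_iff_norm, this]
    refine (norm_add_le _ _).trans_lt ?_
    rw [norm_smul, norm_smul, ha, hb, Real.norm_eq_abs, Real.norm_eq_abs]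
    linarith
  refine MixedNonnegAt.of_punctured (half_pos hρ) (fun t ht => ?_) fun s t hs ht hsσ => ?_
  · have hx := hsub (hball _ (mem σ t (by simpa using half_pos hρ) ht)).1
    have := hv.1.continuousAt (hΩ.mem_nhds hx)
    exact ContinuousAt.comp (f := fun s : ℝ => c + s • a + t • b) (g := v) this (by fun_prop)
  · have hx := hball _ (mem s t hs ht)
    -- In this ball the only possible vertex is w, and by independence of a and b it occurs only for
    -- s = σ.
    refine (isRidgeAt_of_not_vertex hK hΩ hsub hE hv hc hx.1 fun hvert => hsσ ?_).mixedNonnegAt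
      ha hb rfl
    have h := hx.2 _ hvert (by simp)
    simp only [Finset.coe_singleton, convexHull_singleton, Set.mem_singleton_iff] at h
    have h' : (σ - s) • a + (τ - t) • b = 0 := by
      rw [← sub_eq_zero.2 h, hw]; module
    have := (LinearIndependent.pair_iff.1 hab _ _ h').1
    linarith

/-! ### The quadratic function -/

/-- For linearly independent `a`, `b`, there is a positive definite matrix for which the inner
product of `a` and `b` is negative. -/
theorem exists_posDef_neg {a b : Plane} (hab : LinearIndependent ℝ ![a, b]) :
    ∃ M : Matrix (Fin 2) (Fin 2) ℝ, M.PosDef ∧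
      (a : Fin 2 → ℝ) ⬝ᵥ (M *ᵥ (b : Fin 2 → ℝ)) < 0 := by
  have hdet : a 0 * b 1 - a 1 * b 0 ≠ 0 := by
    intro h
    have h1 := LinearIndependent.pair_iff.1 hab (b 1) (-(a 1)) (by
      ext i; fin_cases i
      · simp; linarith
      · simp; ring)
    have h2 := LinearIndependent.pair_iff.1 hab (b 0) (-(a 0)) (by
      ext i; fin_cases i
      · simp; ring
      · simp; linarith)
    have h3 := LinearIndependent.pair_iff.1 hab 1 0 (by
      ext i; fin_cases i
      · simpa using h2.2
      · simpa using h1.2)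
    exact one_ne_zero h3.1
  -- With D = det(a, b), N sends a to (0, -D) and b to (D, 0), so the off-diagonal entry 1 of the
  -- middle matrix yields -D².
  let N : Matrix (Fin 2) (Fin 2) ℝ := !![-(a 1), a 0; -(b 1), b 0]
  have hN : ∀ x : Fin 2 → ℝ, x ⬝ᵥ ((Nᵀ * !![2, 1; 1, 2] * N) *ᵥ x) =
      (N *ᵥ x) 0 ^ 2 + (N *ᵥ x) 1 ^ 2 + ((N *ᵥ x) 0 + (N *ᵥ x) 1) ^ 2 := by
    intro x
    simp [N, Matrix.mulVec, dotProduct, Fin.sum_univ_two, Matrix.mul_apply]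
    ring
  refine ⟨Nᵀ * !![2, 1; 1, 2] * N, ?_, ?_⟩
  · refine Matrix.PosDef.of_dotProduct_mulVec_pos ?_ fun x hx => ?_
    · ext i j
      fin_cases i <;> fin_cases j <;> simp [Matrix.mul_apply, Fin.sum_univ_two] <;> ring
    · rw [star_trivial, hN]
      have hne : (N *ᵥ x) 0 ≠ 0 ∨ (N *ᵥ x) 1 ≠ 0 := by
        by_contra! h
        obtain ⟨h0, h1⟩ := h
        simp [N, Matrix.mulVec, dotProduct, Fin.sum_univ_two] at h0 h1
        apply hx
        ext i; fin_cases i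
        · apply (mul_eq_zero.1 (_ : (a 0 * b 1 - a 1 * b 0) * x 0 = 0)).resolve_left hdet
          linear_combination b 0 * h0 - a 0 * h1
        · apply (mul_eq_zero.1 (_ : (a 0 * b 1 - a 1 * b 0) * x 1 = 0)).resolve_left hdet
          linear_combination b 1 * h0 - a 1 * h1
      rcases hne with h | h <;> positivity
  · have : (a : Fin 2 → ℝ) ⬝ᵥ ((Nᵀ * !![2, 1; 1, 2] * N) *ᵥ (b : Fin 2 → ℝ)) =
        -(a 0 * b 1 - a 1 * b 0) ^ 2 := by
      simp [N, Matrix.mulVec, dotProduct, Fin.sum_univ_two, Matrix.mul_apply]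
      ring
    rw [this]
    have := pow_pos (abs_pos.2 hdet) 2
    rw [sq_abs] at this
    linarith

theorem contDiff_quadratic (M : Matrix (Fin 2) (Fin 2) ℝ) :
    ContDiff ℝ ∞ fun x : Plane => ((x : Fin 2 → ℝ) ⬝ᵥ (M *ᵥ (x : Fin 2 → ℝ))) / 2 := by
  simp only [Matrix.mulVec, dotProduct, Fin.sum_univ_two]
  fun_prop

theorem convexOn_quadratic {M : Matrix (Fin 2) (Fin 2) ℝ} (hM : M.PosSemidef) :
    ConvexOn ℝ Set.univ fun x : Plane => ((x : Fin 2 → ℝ) ⬝ᵥ (M *ᵥ (x : Fin 2 → ℝ))) / 2 := by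
  refine ⟨convex_univ, fun x _ y _ p q hp hq hpq => ?_⟩
  have h := hM.dotProduct_mulVec_nonneg ((x : Fin 2 → ℝ) - (y : Fin 2 → ℝ))
  rw [star_trivial] at h
  have h' := mul_nonneg (mul_nonneg hp hq) h
  obtain rfl : q = 1 - p := by linarith
  simp [Matrix.mulVec, dotProduct, Fin.sum_univ_two] at h' ⊢
  linarith

/-- Only the cross term in s t survives. It does not depend on c, which makes the gap uniform over
base points. -/
theorem mixedDiff_quadratic {M : Matrix (Fin 2) (Fin 2) ℝ} (hM : M.IsHermitian) (a b c : Plane)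
    (s t : ℝ) :
    mixedDiff (fun s t : ℝ =>
      (((c + s • a + t • b : Plane) : Fin 2 → ℝ) ⬝ᵥ
        (M *ᵥ ((c + s • a + t • b : Plane) : Fin 2 → ℝ))) / 2) 0 s 0 t =
      s * t * ((a : Fin 2 → ℝ) ⬝ᵥ (M *ᵥ (b : Fin 2 → ℝ))) := by
  have h := hM.apply 0 1
  rw [star_trivial] at h
  simp [mixedDiff, Matrix.mulVec, dotProduct, Fin.sum_univ_two, h]
  ring

/-! ### From mixed differences to the L² norm -/

open MeasureTheory in
/-- If mixed second differences of `f` with a fixed step are bounded below by `δ` in a ball, the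
`L²` norm of `f` is bounded below. -/
theorem le_eLpNorm_of_mixedDiff {f : Plane → ℝ} {Ω : Set Plane} (hΩ : IsOpen Ω)
    (hf : ContinuousOn f Ω) {p q z : Plane} {ρ δ : ℝ} (hδ : 0 ≤ δ)
    (h00 : Metric.ball z ρ ⊆ Ω)
    (h10 : ∀ x ∈ Metric.ball z ρ, x + p ∈ Ω) (h01 : ∀ x ∈ Metric.ball z ρ, x + q ∈ Ω)
    (h11 : ∀ x ∈ Metric.ball z ρ, x + (p + q) ∈ Ω)
    (h : ∀ x ∈ Metric.ball z ρ, δ ≤ f (x + (p + q)) - f (x + p) - f (x + q) + f x) :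
    ENNReal.ofReal δ * volume (Metric.ball z ρ) ^ (1 / 2 : ℝ) ≤
      4 * eLpNorm f 2 (volume.restrict Ω) := by
  have hmeas : AEStronglyMeasurable f (volume.restrict Ω) := hf.aestronglyMeasurable hΩ.measurableSet
  set B := Metric.ball z ρ with hB
  -- By translation invariance, each of the four corner terms has L² norm on B at most that of f on
  -- Ω.
  have shift : ∀ y : Plane, (∀ x ∈ B, x + y ∈ Ω) →
      AEStronglyMeasurable (fun x => f (x + y)) (volume.restrict B) ∧
      eLpNorm (fun x => f (x + y)) 2 (volume.restrict B) ≤ eLpNorm f 2 (volume.restrict Ω) := by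
    intro y hy
    have hle : (volume.restrict B : Measure Plane) ≤
        volume.restrict ((fun x => x + y) ⁻¹' Ω) := Measure.restrict_mono hy le_rfl
    have hmp : MeasurePreserving (fun x : Plane => x + y) (volume.restrict ((fun x => x + y) ⁻¹' Ω))
        (volume.restrict Ω) :=
      (measurePreserving_add_right volume y).restrict_preimage hΩ.measurableSet
    refine ⟨(hmeas.comp_measurePreserving hmp).mono_measure hle, ?_⟩
    refine (eLpNorm_mono_measure _ hle).trans ?_
    exact (eLpNorm_comp_measurePreserving hmeas hmp).le
  have s11 := shift (p + q) h11
  have s10 := shift p h10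
  have s01 := shift q h01
  have s00 := shift 0 (by simpa using fun x hx => h00 hx)
  simp only [add_zero] at s00
  calc ENNReal.ofReal δ * volume B ^ (1 / 2 : ℝ)
      = eLpNorm (fun _ : Plane => δ) 2 (volume.restrict B) := by
        rw [eLpNorm_const' _ (by norm_num) (by norm_num), Real.enorm_of_nonneg hδ]
        simp
    _ ≤ eLpNorm ((((fun x => f (x + (p + q))) - fun x => f (x + p)) - fun x => f (x + q)) + f) 2
          (volume.restrict B) := by
        refine eLpNorm_mono_ae ?_
        filter_upwards [ae_restrict_mem Metric.isOpen_ball.measurableSet] with x hx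
        rw [Real.norm_of_nonneg hδ]
        exact (h x hx).trans (le_abs_self _)
    _ ≤ eLpNorm f 2 (volume.restrict Ω) + eLpNorm f 2 (volume.restrict Ω) +
          eLpNorm f 2 (volume.restrict Ω) + eLpNorm f 2 (volume.restrict Ω) := by
        refine (eLpNorm_add_le ((s11.1.sub s10.1).sub s01.1) s00.1 (by norm_num)).trans ?_
        refine add_le_add ?_ s00.2
        refine (eLpNorm_sub_le (s11.1.sub s10.1) s01.1 (by norm_num)).trans ?_
        refine add_le_add ?_ s01.2
        refine (eLpNorm_sub_le s11.1 s10.1 (by norm_num)).trans ?_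
        exact add_le_add s11.2 s10.2
    _ = 4 * eLpNorm f 2 (volume.restrict Ω) := by ring

theorem theorem3 {ι : Type*} (Ω Ω' : Set Plane) (hΩ : IsOpen Ω) (hΩ' : IsOpen Ω')
    (hne : Ω'.Nonempty) (hsub : Ω' ⊆ Ω)
    (𝒯 : ι → Geometry.SimplicialComplex ℝ Plane) (h𝒯 : ∀ h, IsTriangulation (𝒯 h) Ω)
    (hPM : ∃ a b : Plane, ‖a‖ = 1 ∧ ‖b‖ = 1 ∧ LinearIndependent ℝ ![a, b] ∧
      ∀ h, EdgeNormalSign (𝒯 h) Ω' a b) :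
    ∃ ε : ℝ, 0 < ε ∧ ∃ u : Plane → ℝ, ContDiff ℝ ∞ u ∧ ConvexOn ℝ Set.univ u ∧
      (∃ (C : Matrix (Fin 2) (Fin 2) ℝ) (k : ℝ), C.PosDef ∧
        ∀ x : Plane, u x = ((x : Fin 2 → ℝ) ⬝ᵥ (C⁻¹ *ᵥ (x : Fin 2 → ℝ))) / 2 - k) ∧
      ∀ (h : ι) (v : Plane → ℝ), IsP1 (𝒯 h) Ω v → IsConvexIn Ω v →
        ENNReal.ofReal ε ≤
            MeasureTheory.eLpNorm (v - u) 2 (MeasureTheory.volume.restrict Ω') ∧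
        ENNReal.ofReal ε ≤
            MeasureTheory.eLpNorm (v - u) 2 (MeasureTheory.volume.restrict Ω) := by
  obtain ⟨a, b, ha, hb, hab, hE⟩ := hPM
  obtain ⟨M, hM, hneg⟩ := exists_posDef_neg hab
  obtain ⟨z, hz⟩ := hne
  obtain ⟨R, hR, hball⟩ := Metric.isOpen_iff.1 hΩ' z hz
  set κ := (a : Fin 2 → ℝ) ⬝ᵥ (M *ᵥ (b : Fin 2 → ℝ)) with hκ
  -- Base points in the ball of radius R/2 and sides R/8 along unit vectors keep the parallelograms
  -- inside the ball of radius R; δ is minus the mixed difference of u over them.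
  set δ : ℝ := R / 8 * (R / 8) * -κ with hδdef
  have hδ : 0 < δ := by
    have : 0 < -κ := by linarith
    positivity
  set u : Plane → ℝ := fun x => ((x : Fin 2 → ℝ) ⬝ᵥ (M *ᵥ (x : Fin 2 → ℝ))) / 2 with hu
  set c : ENNReal := ENNReal.ofReal δ *
    MeasureTheory.volume (Metric.ball z (R / 2)) ^ (1 / 2 : ℝ) / 4 with hc
  have hvol : MeasureTheory.volume (Metric.ball z (R / 2)) ≠ ⊤ :=
    MeasureTheory.measure_ball_lt_top.ne
  have hvol0 : 0 < MeasureTheory.volume (Metric.ball z (R / 2)) :=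
    Metric.measure_ball_pos _ _ (half_pos hR)
  have hc0 : c ≠ 0 := by
    refine (ENNReal.div_pos (mul_ne_zero ?_ ?_) (by simp)).ne'
    · simpa using hδ
    · exact (ENNReal.rpow_pos hvol0 hvol).ne'
  have hctop : c ≠ ⊤ := ENNReal.div_ne_top
    (ENNReal.mul_ne_top ENNReal.ofReal_ne_top (ENNReal.rpow_ne_top_of_nonneg (by norm_num) hvol))
    (by norm_num)
  have hinv : M⁻¹⁻¹ = M := Matrix.nonsing_inv_nonsing_inv M hM.det_pos.ne'.isUnit
  refine ⟨c.toReal, ENNReal.toReal_pos hc0 hctop, u, contDiff_quadratic M,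
    convexOn_quadratic hM.posSemidef, ⟨M⁻¹, 0, hM.inv, fun x => by rw [hinv, sub_zero]⟩,
    fun h v hv hconv => ?_⟩
  rw [ENNReal.ofReal_toReal hctop]
  have mem : ∀ x ∈ Metric.ball z (R / 2), ∀ s ∈ Set.Icc 0 (R / 8), ∀ t ∈ Set.Icc 0 (R / 8),
      x + s • a + t • b ∈ Ω' := by
    intro x hx s hs t ht
    refine hball ?_
    rw [mem_ball_iff_norm] at hx ⊢
    have e : x + s • a + t • b - z = (x - z) + s • a + t • b := by abel
    rw [e]
    refine (norm_add₃_le).trans_lt ?_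
    rw [norm_smul, norm_smul, ha, hb, Real.norm_of_nonneg hs.1, Real.norm_of_nonneg ht.1]
    linarith [hs.2, ht.2]
  have h0 : (0 : ℝ) ∈ Set.Icc 0 (R / 8) := ⟨le_rfl, by positivity⟩
  have h1 : R / 8 ∈ Set.Icc 0 (R / 8) := ⟨by positivity, le_rfl⟩
  have key : c ≤ MeasureTheory.eLpNorm (v - u) 2 (MeasureTheory.volume.restrict Ω') := by
    rw [hc]
    refine ENNReal.div_le_of_le_mul' ?_
    refine le_eLpNorm_of_mixedDiff hΩ' (p := (R / 8) • a) (q := (R / 8) • b)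
      ((hv.1.mono hsub).sub (contDiff_quadratic M).continuous.continuousOn) hδ.le
      (fun x hx => by simpa using mem x hx 0 h0 0 h0) (fun x hx => by simpa using mem x hx _ h1 0 h0)
      (fun x hx => by simpa using mem x hx 0 h0 _ h1)
      (fun x hx => by simpa [add_assoc] using mem x hx _ h1 _ h1) fun x hx => ?_
    have hpos := mixedDiff_nonneg_of_isP1 (h𝒯 h) hΩ hΩ' hsub ha hb hab (hE h) hv hconv h1.1 h1.1
      (mem x hx)
    have hquad := mixedDiff_quadratic hM.isHermitian a b x (R / 8) (R / 8)
    rw [← hκ] at hquad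
    simp only [mixedDiff, zero_smul, add_zero] at hpos hquad
    simp only [Pi.sub_apply, ← add_assoc]
    -- The contribution of v is nonnegative and that of -u is exactly δ.
    linarith
  exact ⟨key, key.trans
    (MeasureTheory.eLpNorm_mono_measure _ (MeasureTheory.Measure.restrict_mono hsub le_rfl))⟩
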